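/- Let $\mathbb{K}$ be an arbitrary field, let $n$ be a non-negative integer, and let $N$ be a rank $n-1$ matrix of the space $M_n(\mathbb{K})$ of $n \times n$ matrices over $\mathbb{K}$. Let $\mathcal{S}$ be an affine subspace of $M_n(\mathbb{K})$ with $\operatorname{codim} \mathcal{S} \leq n-2$, where $\operatorname{codim} \mathcal{S}$ is the codimension in $M_n(\mathbb{K})$ of the translation vector space of $\mathcal{S}$. Assume that at least one matrix $M \in \mathcal{S}$ maps $\operatorname{Ker} N$ into $\operatorname{Im} N$, that is, $Mx \in \operatorname{Im} N$ for every $x \in \mathbb{K}^n$ with $Nx = 0$. Then there exists $A \in \mathcal{S}$ such that $A + tN$ is invertible for every $t \in \mathbb{K}$. -/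

import Mathlib

open Module Submodule

/-! Let `e` span the kernel of `N` and let `f` be a linear form whose kernel is the image of `N`;
the hypothesis on `M` reads `f (M e) = 0`. Call `A e` the first column of `A` and `f ∘ A` its last
row. If `A e = N x ≠ 0`, then `A + tN` is injective as soon as the pencil induced modulo `e` and `N
x` is. There `N` has corank one again, with the class of `x` as kernel vector, so induction on the
dimension applies (`exists_injective_pencil_of_codim_le`), provided that `f (A x) = 0` and the
codimension drops.

A dimension count (`exists_row_apply_ne_zero`) yields `x`, and `Z` in the translation space `V` with
`Z e = 0` and `f (Z x) ≠ 0`; subtracting a multiple of `Z` makes `f (A x)` vanish.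

If the codimension never drops, `V` attains every first column and contains every map that kills `e`
and has values in the image of `N`. Only the first column and the last row then matter. Over a
finite field, take a corner entry `1` and a block without eigenvalues. Over an infinite field, find
a suitable nonzero row with zero corner and complete it recursively (`exists_injective_pencil`). -/

/-- `N` is a corank one map: its kernel is spanned by the nonzero vector `e`,
and its range is the kernel of the linear form `f`. -/
structure IsCorankOne {K U Y : Type*} [Field K] [AddCommGroup U] [Module K U]
    [AddCommGroup Y] [Module K Y] (N : U →ₗ[K] Y) (e : U) (f : Y →ₗ[K] K) : Prop where
  ne_zero : e ≠ 0
  ker_eq : LinearMap.ker N = span K {e}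
  range_eq : LinearMap.range N = LinearMap.ker f

/-! ### Corank one maps and their quotients. -/

namespace IsCorankOne

variable {K : Type*} [Field K] {U Y : Type*} [AddCommGroup U] [Module K U]
  [AddCommGroup Y] [Module K Y] {N : U →ₗ[K] Y} {e : U} {f : Y →ₗ[K] K}

lemma map_eq_zero_iff (h : IsCorankOne N e f) {u : U} : N u = 0 ↔ ∃ c : K, c • e = u := by
  rw [← LinearMap.mem_ker, h.ker_eq, mem_span_singleton]

lemma apply_self (h : IsCorankOne N e f) : N e = 0 :=
  h.map_eq_zero_iff.2 ⟨1, one_smul _ _⟩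

lemma form_eq_zero_iff (h : IsCorankOne N e f) {y : Y} : f y = 0 ↔ ∃ u, N u = y := by
  rw [← LinearMap.mem_ker, ← h.range_eq, LinearMap.mem_range]

lemma form_apply (h : IsCorankOne N e f) (u : U) : f (N u) = 0 :=
  h.form_eq_zero_iff.2 ⟨u, rfl⟩

lemma apply_ne_zero (h : IsCorankOne N e f) {l : U →ₗ[K] K} (hl : l e = 0) {x : U}
    (hx : l x ≠ 0) : N x ≠ 0 := fun hN => by
  obtain ⟨c, rfl⟩ := h.map_eq_zero_iff.1 hN
  simp [hl] at hx

/-- The quotient of `N` by the kernel vector and by a vector of the range. -/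
def quotientMap (h : IsCorankOne N e f) (x : U) : (U ⧸ span K {e}) →ₗ[K] (Y ⧸ span K {N x}) :=
  mapQ _ _ N (by
    rw [span_singleton_le_iff_mem, mem_comap, h.apply_self]
    exact zero_mem _)

lemma quotientMap_mk (h : IsCorankOne N e f) (x u : U) :
    h.quotientMap x (mkQ _ u) = mkQ _ (N u) := rfl

/-- The form induced by `f` modulo a vector of the range. -/
def quotientForm (h : IsCorankOne N e f) (x : U) : (Y ⧸ span K {N x}) →ₗ[K] K :=
  liftQ _ f (by
    rw [span_singleton_le_iff_mem, LinearMap.mem_ker]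
    exact h.form_apply x)

lemma quotientForm_mk (h : IsCorankOne N e f) (x : U) (y : Y) :
    h.quotientForm x (mkQ _ y) = f y := rfl

lemma quotient (h : IsCorankOne N e f) {x : U} (hx : N x ≠ 0) :
    IsCorankOne (h.quotientMap x) (mkQ _ x) (h.quotientForm x) where
  ne_zero := by
    rw [mkQ_apply, Ne, Quotient.mk_eq_zero, ← h.ker_eq]
    exact hx
  ker_eq := by
    ext u
    obtain ⟨u, rfl⟩ := mkQ_surjective _ u
    rw [LinearMap.mem_ker, quotientMap_mk, mkQ_apply, Quotient.mk_eq_zero, mem_span_singleton,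
      mem_span_singleton]
    refine exists_congr fun c => ?_
    change c • N x = N u ↔ mkQ (span K {e}) (c • x) = mkQ (span K {e}) u
    rw [mkQ_apply, mkQ_apply, Submodule.Quotient.eq, ← h.ker_eq, LinearMap.mem_ker,
      map_sub, map_smul, sub_eq_zero]
  range_eq := by
    ext y
    obtain ⟨y, rfl⟩ := mkQ_surjective _ y
    rw [LinearMap.mem_ker, quotientForm_mk, h.form_eq_zero_iff]
    constructor
    · rintro ⟨u, hu⟩
      obtain ⟨u, rfl⟩ := mkQ_surjective _ u
      rw [quotientMap_mk, mkQ_apply, mkQ_apply, Submodule.Quotient.eq, mem_span_singleton] at hu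
      obtain ⟨c, hc⟩ := hu
      refine ⟨u - c • x, ?_⟩
      rw [map_sub, map_smul, hc, sub_sub_cancel]
    · rintro ⟨u, rfl⟩
      exact ⟨mkQ _ u, rfl⟩

/-- A pencil is injective if it is so modulo `e` and modulo the nonzero image of `e`. -/
lemma injective_of_quotient (h : IsCorankOne N e f) {x : U} (hx : N x ≠ 0) {A : U →ₗ[K] Y}
    (hA : A e = N x) {B : (U ⧸ span K {e}) →ₗ[K] (Y ⧸ span K {N x})}
    (hB : ∀ u, B (mkQ _ u) = mkQ _ (A u)) (t : K)
    (hinj : Function.Injective (B + t • h.quotientMap x)) :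
    Function.Injective (A + t • N) := by
  rw [injective_iff_map_eq_zero] at hinj ⊢
  intro u hu
  have h1 := hinj (mkQ _ u) (by
    rw [LinearMap.add_apply, LinearMap.smul_apply, hB, quotientMap_mk, ← map_smul, ← map_add]
    rw [LinearMap.add_apply, LinearMap.smul_apply] at hu
    rw [hu, map_zero])
  rw [mkQ_apply, Quotient.mk_eq_zero, mem_span_singleton] at h1
  obtain ⟨c, rfl⟩ := h1
  rw [map_smul, LinearMap.add_apply, LinearMap.smul_apply, h.apply_self, smul_zero, add_zero, hA,
    smul_eq_zero, or_iff_left hx] at hu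
  rw [hu, zero_smul]

end IsCorankOne

section Lift

variable {K : Type*} [Field K] {U Y : Type*} [AddCommGroup U] [Module K U]
  [AddCommGroup Y] [Module K Y]

lemma exists_lift_quotient {e : U} (he : e ≠ 0) (y : Y)
    (B : (U ⧸ span K {e}) →ₗ[K] (Y ⧸ span K {y})) :
    ∃ A : U →ₗ[K] Y, A e = y ∧ ∀ u, B (mkQ _ u) = mkQ _ (A u) := by
  obtain ⟨s, hs⟩ := (mkQ (span K {y})).exists_rightInverse_of_surjective (range_mkQ _)
  obtain ⟨p, hp⟩ := Projective.exists_dual_eq_one K he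
  have hs' : ∀ z, mkQ (span K {y}) (s z) = z := fun z => LinearMap.congr_fun hs z
  have he' : mkQ (span K {e}) e = 0 := by
    rw [mkQ_apply, Quotient.mk_eq_zero]; exact mem_span_singleton_self e
  have hy' : mkQ (span K {y}) y = 0 := by
    rw [mkQ_apply, Quotient.mk_eq_zero]; exact mem_span_singleton_self y
  refine ⟨s ∘ₗ B ∘ₗ mkQ _ + p.smulRight y, ?_, fun u => ?_⟩
  · simp only [LinearMap.add_apply, LinearMap.comp_apply, he', map_zero,
      LinearMap.smulRight_apply, hp, one_smul, zero_add]
  · simp only [LinearMap.add_apply, LinearMap.comp_apply, LinearMap.smulRight_apply, map_add, hs',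
      map_smul, hy', smul_zero, add_zero]

lemma finrank_quotient_span_singleton_add_one [FiniteDimensional K U] {e : U} (he : e ≠ 0) :
    finrank K (U ⧸ span K {e}) + 1 = finrank K U := by
  rw [← finrank_span_singleton (K := K) he, finrank_quotient_add_finrank]

end Lift

/-! ### Codimension of preimages and images. -/

section Codim

variable {K : Type*} [Field K] {E F : Type*} [AddCommGroup E] [Module K E]
  [AddCommGroup F] [Module K F]

lemma finrank_quotient_comap_le [FiniteDimensional K F] (g : E →ₗ[K] F) (V : Submodule K F) :
    finrank K (E ⧸ V.comap g) ≤ finrank K (F ⧸ V) := by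
  refine LinearMap.finrank_le_finrank_of_injective (f := mapQ (V.comap g) V g le_rfl) ?_
  rw [← LinearMap.ker_eq_bot, ker_mapQ, ← mkQ_map_self]

lemma finrank_quotient_comap_lt [FiniteDimensional K E] [FiniteDimensional K F]
    (g : E →ₗ[K] F) (V : Submodule K F)
    (h : ¬ ∀ z, ∃ a, z - g a ∈ V) :
    finrank K (E ⧸ V.comap g) < finrank K (F ⧸ V) := by
  refine (finrank_quotient_comap_le g V).lt_of_ne fun heq => h fun z => ?_
  have hinj : Function.Injective (mapQ (V.comap g) V g le_rfl) := by
    rw [← LinearMap.ker_eq_bot, ker_mapQ, ← mkQ_map_self]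
  obtain ⟨a, ha⟩ := (LinearMap.injective_iff_surjective_of_finrank_eq_finrank heq).1 hinj (mkQ _ z)
  obtain ⟨a, rfl⟩ := mkQ_surjective _ a
  refine ⟨a, ?_⟩
  rw [← Submodule.Quotient.eq]
  exact ha.symm

lemma finrank_quotient_map_le [FiniteDimensional K E] {g : E →ₗ[K] F} (hg : Function.Surjective g) (W : Submodule K E) :
    finrank K (F ⧸ W.map g) ≤ finrank K (E ⧸ W) := by
  refine LinearMap.finrank_le_finrank_of_surjective (f := mapQ W (W.map g) g (le_comap_map g W)) ?_
  intro y
  obtain ⟨y, rfl⟩ := mkQ_surjective _ y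
  obtain ⟨x, rfl⟩ := hg y
  exact ⟨mkQ _ x, rfl⟩

lemma finrank_quotient_map_lt [FiniteDimensional K E] [FiniteDimensional K F]
    {g : E →ₗ[K] F} (hg : Function.Surjective g) (W : Submodule K E)
    (h : ¬ LinearMap.ker g ≤ W) :
    finrank K (F ⧸ W.map g) < finrank K (E ⧸ W) := by
  refine (finrank_quotient_map_le hg W).lt_of_ne fun heq => h fun z hz => ?_
  have hsurj : Function.Surjective (mapQ W (W.map g) g (le_comap_map g W)) := by
    intro y
    obtain ⟨y, rfl⟩ := mkQ_surjective _ y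
    obtain ⟨x, rfl⟩ := hg y
    exact ⟨mkQ _ x, rfl⟩
  have hinj := (LinearMap.injective_iff_surjective_of_finrank_eq_finrank heq.symm).2 hsurj
  rw [← Quotient.mk_eq_zero]
  apply hinj
  rw [map_zero]
  change mkQ (W.map g) (g z) = 0
  rw [LinearMap.mem_ker.1 hz, map_zero]

lemma finrank_range_le_finrank_map_add [FiniteDimensional K E] (g : E →ₗ[K] F)
    (V : Submodule K E) :
    finrank K (LinearMap.range g) ≤ finrank K (V.map g) + finrank K (E ⧸ V) := by
  obtain ⟨W, hW⟩ := V.exists_isCompl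
  rw [(quotientEquivOfIsCompl V W hW).finrank_eq, LinearMap.range_eq_map, ← hW.sup_eq_top,
    Submodule.map_sup]
  exact (finrank_add_le_finrank_add_finrank _ _).trans
    (Nat.add_le_add_left (finrank_map_le g W) _)

end Codim

/-! ### Completing a pencil with prescribed last row. -/

section Completion

universe u v
variable {K : Type u} [Field K]

lemma exists_form_apply_eq_zero_of_one_lt {U : Type*} [AddCommGroup U] [Module K U]
    [FiniteDimensional K U] (e : U) (l : U →ₗ[K] K) (hU : 2 < finrank K U) :
    ∃ x, l x = 0 ∧ x ∉ span K {e} := by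
  by_contra! hcon
  have h1 : finrank K (LinearMap.ker l) ≤ 1 :=
    (Submodule.finrank_mono (show LinearMap.ker l ≤ span K {e} from hcon)).trans
      ((finrank_span_le_card {e}).trans (by simp))
  have h2 := l.finrank_range_add_finrank_ker
  have h3 : finrank K (LinearMap.range l) ≤ 1 := by
    simpa using Submodule.finrank_le (LinearMap.range l)
  omega

namespace IsCorankOne

/-- Completion step: a pencil modulo `e` and `N x` with prescribed last row lifts. -/
lemma exists_injective_pencil_of_quotient {U Y : Type*} [AddCommGroup U] [Module K U]
    [AddCommGroup Y] [Module K Y] {N : U →ₗ[K] Y} {e : U} {f : Y →ₗ[K] K}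
    (h : IsCorankOne N e f) {x : U} (hx : N x ≠ 0) {l : U →ₗ[K] K}
    {l' : (U ⧸ span K {e}) →ₗ[K] K} (hl' : ∀ u, l' (mkQ _ u) = l u)
    (hq : ∃ B : (U ⧸ span K {e}) →ₗ[K] (Y ⧸ span K {N x}),
      (∀ u, h.quotientForm x (B u) = l' u) ∧
      ∀ t : K, Function.Injective (B + t • h.quotientMap x)) :
    ∃ A : U →ₗ[K] Y, A e = N x ∧ (∀ u, f (A u) = l u) ∧
      ∀ t : K, Function.Injective (A + t • N) := by
  obtain ⟨B, hB, hinj⟩ := hq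
  obtain ⟨A, hA, hAB⟩ := exists_lift_quotient h.ne_zero (N x) B
  refine ⟨A, hA, fun u => ?_, fun t => h.injective_of_quotient hx hA hAB t (hinj t)⟩
  rw [← h.quotientForm_mk x, ← hAB, hB, hl']

/-- Since `l e = 0`, the row descends modulo `e`; choosing `x` in the kernel of `l` makes the new
row vanish at the new kernel vector. In dimension one a nonzero row cannot vanish at `e`, hence the
guard `0 < n`. -/
lemma exists_injective_pencil (n : ℕ) : ∀ {U Y : Type v} [AddCommGroup U] [Module K U]
    [AddCommGroup Y] [Module K Y] [FiniteDimensional K U] [FiniteDimensional K Y]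
    {N : U →ₗ[K] Y} {e : U} {f : Y →ₗ[K] K} (_ : IsCorankOne N e f)
    (_ : finrank K U = n + 1) (_ : finrank K Y = n + 1)
    (l : U →ₗ[K] K) (_ : l ≠ 0) (_ : 0 < n → l e = 0),
    ∃ A : U →ₗ[K] Y, (∀ u, f (A u) = l u) ∧ ∀ t : K, Function.Injective (A + t • N) := by
  induction n with
  | zero =>
    intro U Y _ _ _ _ _ _ N e f h hU hY l hl _
    have hspan : ∀ u : U, ∃ c : K, c • e = u := (finrank_eq_one_iff_of_nonzero' e h.ne_zero).1 hU
    have hN : N = 0 := LinearMap.ext fun u => h.map_eq_zero_iff.2 (hspan u)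
    have hf : f ≠ 0 := by
      rintro rfl
      obtain ⟨y, hy⟩ := (finrank_pos_iff_exists_ne_zero (R := K) (M := Y)).1 (by omega)
      obtain ⟨u, hu⟩ := h.form_eq_zero_iff.1 (LinearMap.zero_apply y)
      exact hy (by rw [← hu, hN, LinearMap.zero_apply])
    obtain ⟨v, hv⟩ : ∃ v, f v = 1 := LinearMap.surjective hf 1
    refine ⟨l.smulRight v, fun u => by simp [hv], fun t => ?_⟩
    rw [hN, smul_zero, add_zero, injective_iff_map_eq_zero]
    intro u hu
    have h1 : l u = 0 := by simpa [hv] using congrArg f hu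
    obtain ⟨c, rfl⟩ := hspan u
    by_contra hne
    refine hl (LinearMap.ext fun w => ?_)
    obtain ⟨d, rfl⟩ := hspan w
    have hc : c ≠ 0 := fun hc => hne (by rw [hc, zero_smul])
    rw [map_smul, smul_eq_mul, mul_eq_zero, or_iff_right hc] at h1
    rw [map_smul, h1, smul_zero, LinearMap.zero_apply]
  | succ n ih =>
    intro U Y _ _ _ _ _ _ N e f h hU hY l hl hle'
    have hle := hle' n.succ_pos
    clear hle'
    obtain ⟨x, hx, hlx⟩ : ∃ x, N x ≠ 0 ∧ (0 < n → l x = 0) := by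
      rcases Nat.eq_zero_or_pos n with rfl | hn
      · obtain ⟨x, hx⟩ : ∃ x, l x ≠ 0 := by
          by_contra! hcon
          exact hl (LinearMap.ext hcon)
        exact ⟨x, h.apply_ne_zero hle hx, fun h0 => absurd h0 (lt_irrefl _)⟩
      · obtain ⟨x, hlx, hx⟩ := exists_form_apply_eq_zero_of_one_lt e l (by omega)
        exact ⟨x, fun h0 => hx (h.ker_eq ▸ h0), fun _ => hlx⟩
    have hU' := finrank_quotient_span_singleton_add_one (K := K) h.ne_zero
    have hY' := finrank_quotient_span_singleton_add_one (K := K) hx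
    have hle' : span K {e} ≤ LinearMap.ker l := by
      rwa [span_singleton_le_iff_mem, LinearMap.mem_ker]
    obtain ⟨A, -, hA⟩ := h.exists_injective_pencil_of_quotient hx
      (l' := liftQ _ l hle') (fun u => rfl)
      (ih (h.quotient hx) (by omega) (by omega) _ (fun h0 => hl (by
        rw [← liftQ_mkQ _ l hle', h0, LinearMap.zero_comp])) hlx)
    exact ⟨A, hA⟩

/-- There is an everywhere injective pencil `A + t N` with prescribed first column `A e = N x`
and prescribed last row `f ∘ A = l`. -/
lemma exists_injective_pencil_of_row_of_column {U Y : Type v} [AddCommGroup U] [Module K U]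
    [AddCommGroup Y] [Module K Y] [FiniteDimensional K U] [FiniteDimensional K Y]
    {N : U →ₗ[K] Y} {e : U} {f : Y →ₗ[K] K} (h : IsCorankOne N e f)
    (hU : 2 ≤ finrank K U) (hY : finrank K Y = finrank K U)
    {x : U} (hx : N x ≠ 0) {l : U →ₗ[K] K} (hl : l ≠ 0) (hle : l e = 0) (hlx : l x = 0) :
    ∃ A : U →ₗ[K] Y, A e = N x ∧ (∀ u, f (A u) = l u) ∧
      ∀ t : K, Function.Injective (A + t • N) := by
  have hU' := finrank_quotient_span_singleton_add_one (K := K) h.ne_zero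
  have hY' := finrank_quotient_span_singleton_add_one (K := K) hx
  have hle' : span K {e} ≤ LinearMap.ker l := by
    rwa [span_singleton_le_iff_mem, LinearMap.mem_ker]
  obtain ⟨n, hn⟩ := Nat.exists_eq_add_of_le hU
  exact h.exists_injective_pencil_of_quotient hx
    (l' := liftQ _ l hle') (fun u => rfl)
    (exists_injective_pencil n (h.quotient hx) (by omega) (by omega) _ (fun h0 => hl (by
      rw [← liftQ_mkQ _ l hle', h0, LinearMap.zero_comp])) (fun _ => hlx))

end IsCorankOne

end Completion

/-! ### Endomorphisms without eigenvalues. -/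

section FiniteField

/-- Over a finite field, a space of dimension at least two has an endomorphism
without eigenvalues. -/
lemma exists_endomorphism_forall_injective_add_smul {K W : Type*} [Field K] [Finite K]
    [AddCommGroup W] [Module K W] [FiniteDimensional K W] (hW : 2 ≤ finrank K W) :
    ∃ R : W →ₗ[K] W, ∀ t : K, ∀ w, R w + t • w = 0 → w = 0 := by
  obtain ⟨p, hp⟩ := CharP.exists K
  have : Fact p.Prime := ⟨CharP.char_is_prime K p⟩
  have : NeZero (finrank K W) := ⟨by omega⟩
  let L := FiniteField.Extension K p (finrank K W)
  have hL : finrank K L = finrank K W := FiniteField.finrank_extension K p _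
  let φ : W ≃ₗ[K] L := LinearEquiv.ofFinrankEq _ _ hL.symm
  -- For `a` outside `K`, every `a + t` is nonzero in the field `L`, so multiplication by it is
  -- injective.
  obtain ⟨a, ha⟩ : ∃ a : L, ∀ t : K, algebraMap K L t ≠ a := by
    by_contra! hcon
    have := LinearMap.finrank_le_finrank_of_surjective (f := Algebra.linearMap K L) hcon
    rw [finrank_self] at this
    omega
  refine ⟨φ.symm.toLinearMap ∘ₗ LinearMap.mulLeft K a ∘ₗ φ.toLinearMap, fun t w hw => ?_⟩
  have h1 : (a + algebraMap K L t) * φ w = 0 := by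
    have := congrArg φ hw
    simpa [add_mul, Algebra.smul_def] using this
  rcases mul_eq_zero.1 h1 with h2 | h2
  · exact absurd (by rw [map_neg]; exact (eq_neg_of_add_eq_zero_left h2).symm) (ha (-t))
  · simpa using h2

end FiniteField

/-! ### Reducing the translation space modulo two vectors. -/

section Reduction

variable {K : Type*} [Field K] {U Y : Type*} [AddCommGroup U] [Module K U]
  [AddCommGroup Y] [Module K Y]

/-- The maps induced modulo `e` and `y` by the elements of `V` that vanish at `e`. -/
def reducedSpace (V : Submodule K (U →ₗ[K] Y)) (e : U) (y : Y) :
    Submodule K ((U ⧸ span K {e}) →ₗ[K] (Y ⧸ span K {y})) :=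
  (V.comap (LinearMap.lcomp K Y (mkQ (span K {e})))).map
    (LinearMap.compRight K (mkQ (span K {y})))

lemma exists_of_mem_reducedSpace {V : Submodule K (U →ₗ[K] Y)} {e : U} {y : Y}
    {B : (U ⧸ span K {e}) →ₗ[K] (Y ⧸ span K {y})} (hB : B ∈ reducedSpace V e y) :
    ∃ Z ∈ V, Z e = 0 ∧ ∀ u, B (mkQ _ u) = mkQ _ (Z u) := by
  obtain ⟨C, hC, rfl⟩ := hB
  refine ⟨C ∘ₗ mkQ _, hC, ?_, fun u => rfl⟩
  rw [LinearMap.comp_apply, (mkQ_apply _ e).trans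
    ((Quotient.mk_eq_zero _).2 (mem_span_singleton_self e)), map_zero]

lemma compRight_mkQ_surjective {E : Type*} [AddCommGroup E] [Module K E] (S : Submodule K Y) :
    Function.Surjective (LinearMap.compRight K (mkQ S) : (E →ₗ[K] Y) →ₗ[K] (E →ₗ[K] (Y ⧸ S))) := by
  intro B
  obtain ⟨s, hs⟩ := (mkQ S).exists_rightInverse_of_surjective (range_mkQ _)
  refine ⟨s ∘ₗ B, ?_⟩
  change mkQ S ∘ₗ s ∘ₗ B = B
  rw [← LinearMap.comp_assoc, hs, LinearMap.id_comp]

/-- A space containing all rank one maps `p ⊗ y` with `p e = 0` and `f y = 0` contains all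
the maps that vanish at `e` and take their values in the kernel of `f`. -/
lemma mem_of_smulRight_mem [FiniteDimensional K U] {V : Submodule K (U →ₗ[K] Y)} {e : U} (he : e ≠ 0) {f : Y →ₗ[K] K}
    (hV : ∀ p : U →ₗ[K] K, p e = 0 → ∀ y, f y = 0 → p.smulRight y ∈ V)
    {Z : U →ₗ[K] Y} (hZe : Z e = 0) (hZ : ∀ u, f (Z u) = 0) : Z ∈ V := by
  obtain ⟨p, hp⟩ := Projective.exists_dual_eq_one K he
  let b := finBasis K U
  -- As `Z e = 0`, `u` may be projected along `e` before it is expanded in the basis; the coordinate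
  -- forms then vanish at `e`.
  have key : Z = ∑ i, (b.coord i ∘ₗ (LinearMap.id - p.smulRight e)).smulRight (Z (b i)) := by
    ext u
    have h1 : Z u = Z (u - p u • e) := by rw [map_sub, map_smul, hZe, smul_zero, sub_zero]
    rw [h1]
    conv_lhs => rw [← b.sum_repr (u - p u • e)]
    simp only [map_sum, map_smul, LinearMap.sum_apply, LinearMap.smulRight_apply,
      LinearMap.comp_apply, LinearMap.sub_apply, LinearMap.id_apply, Basis.coord_apply]
  rw [key]
  refine sum_mem fun i _ => hV _ ?_ _ (hZ _)
  rw [LinearMap.comp_apply, LinearMap.sub_apply, LinearMap.id_apply, LinearMap.smulRight_apply, hp,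
    one_smul, sub_self, map_zero]

/-- Adding a multiple of `Z` kills the entry `f (A x)`. -/
lemma exists_correct_row {e : U} {f : Y →ₗ[K] K}
    {V : Submodule K (U →ₗ[K] Y)} {M X Z : U →ₗ[K] Y} (hX : X ∈ V)
    (hZ : Z ∈ V) (hZe : Z e = 0) {x : U} (hZx : f (Z x) ≠ 0) :
    ∃ X' ∈ V, (M + X') e = (M + X) e ∧ f ((M + X') x) = 0 := by
  refine ⟨X - (f ((M + X) x) / f (Z x)) • Z, sub_mem hX (smul_mem _ _ hZ), ?_, ?_⟩
  · simp [hZe]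
  · simp only [LinearMap.add_apply, LinearMap.sub_apply, LinearMap.smul_apply, map_add, map_sub,
      map_smul, smul_eq_mul]
    field_simp
    ring

variable [FiniteDimensional K U] [FiniteDimensional K Y]

/-- The codimension drops in the reduction unless `V` contains all the obvious matrices. -/
lemma finrank_quotient_reducedSpace_lt {V : Submodule K (U →ₗ[K] Y)} {e : U} (he : e ≠ 0) {y : Y}
    (h : ¬ ((∀ w, ∃ Z ∈ V, Z e = w) ∧ ∀ p : U →ₗ[K] K, p e = 0 → p.smulRight y ∈ V)) :
    finrank K (((U ⧸ span K {e}) →ₗ[K] (Y ⧸ span K {y})) ⧸ reducedSpace V e y) <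
      finrank K ((U →ₗ[K] Y) ⧸ V) := by
  rw [not_and_or] at h
  -- Restricting to maps that vanish at `e` lowers the codimension unless `V` attains all values at
  -- `e`; passing modulo `y` lowers it unless `V` contains every `p ⊗ y` with `p e = 0`.
  rcases h with h | h
  · refine (finrank_quotient_map_le (compRight_mkQ_surjective _) _).trans_lt
      (finrank_quotient_comap_lt _ _ fun hcon => h fun w => ?_)
    obtain ⟨p, hp⟩ := Projective.exists_dual_eq_one K he
    obtain ⟨a, ha⟩ := hcon (p.smulRight w)
    refine ⟨_, ha, ?_⟩
    have he' : mkQ (span K {e}) e = 0 :=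
      (mkQ_apply _ e).trans ((Quotient.mk_eq_zero _).2 (mem_span_singleton_self e))
    rw [LinearMap.sub_apply, LinearMap.smulRight_apply, LinearMap.lcomp_apply, he', map_zero, hp,
      one_smul, sub_zero]
  · refine (finrank_quotient_map_lt (compRight_mkQ_surjective _) _ fun hcon => h fun p hp => ?_).trans_le
      (finrank_quotient_comap_le _ _)
    have hp' : span K {e} ≤ LinearMap.ker p := by
      rwa [span_singleton_le_iff_mem, LinearMap.mem_ker]
    refine hcon (x := (liftQ _ p hp').smulRight y) (LinearMap.mem_ker.2 (LinearMap.ext fun u => ?_))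
    change mkQ (span K {y}) (liftQ _ p hp' u • y) = 0
    rw [map_smul, (mkQ_apply _ y).trans
      ((Quotient.mk_eq_zero _).2 (mem_span_singleton_self y)), smul_zero]

end Reduction

/-! ### The dimension count, and the finite field case. -/

namespace IsCorankOne

section

variable {K : Type*} [Field K] {U Y : Type*} [AddCommGroup U] [Module K U]
  [AddCommGroup Y] [Module K Y] [FiniteDimensional K U] [FiniteDimensional K Y]
  {N : U →ₗ[K] Y} {e : U} {f : Y →ₗ[K] K}

lemma exists_form_eq_one (h : IsCorankOne N e f) (hUY : finrank K U = finrank K Y) :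
    ∃ v, f v = 1 := by
  refine LinearMap.surjective ?_ 1
  rintro rfl
  have h1 : Function.Surjective N := LinearMap.range_eq_top.1 (by rw [h.range_eq, LinearMap.ker_zero])
  exact h.ne_zero ((LinearMap.injective_iff_surjective_of_finrank_eq_finrank hUY).2 h1
    (by rw [h.apply_self, map_zero]))

/-- Let `C` be the set of values at `e` of elements of `V`, and `E` its preimage under `N`, so that
`dim E ≥ dim C`. The map `Φ` has rank at least `dim Y + dim E - 1`, the loss of 1 coming from the
shared entry `f (Z e)`. If the claim fails, `Z e` determines `Φ Z` on `V`, so the image of `V` has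
dimension at most `dim C`, which forces the codimension of `V` to be at least `dim Y - 1`. -/
lemma exists_row_apply_ne_zero (h : IsCorankOne N e f) (hUY : finrank K U = finrank K Y)
    {V : Submodule K (U →ₗ[K] Y)} (hV : finrank K ((U →ₗ[K] Y) ⧸ V) + 2 ≤ finrank K U) :
    ∃ x, (∃ X ∈ V, X e = N x) ∧ ∃ Z ∈ V, Z e = 0 ∧ f (Z x) ≠ 0 := by
  by_contra! hcon
  obtain ⟨v, hv⟩ := h.exists_form_eq_one hUY
  obtain ⟨p, hp⟩ := Projective.exists_dual_eq_one K h.ne_zero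
  let C : Submodule K Y := V.map (LinearMap.applyₗ e)
  let E : Submodule K U := C.comap N
  have heE : e ∈ E := by
    rw [mem_comap, h.apply_self]; exact zero_mem _
  have hE : finrank K (U ⧸ E) ≤ finrank K (Y ⧸ C) := finrank_quotient_comap_le N C
  have hE1 := E.finrank_quotient_add_finrank
  have hC1 := C.finrank_quotient_add_finrank
  let Φ : (U →ₗ[K] Y) →ₗ[K] Y × (E →ₗ[K] K) :=
    { toFun := fun Z => (Z e, f ∘ₗ Z ∘ₗ E.subtype)
      map_add' := fun Z Z' => Prod.ext rfl (LinearMap.ext fun u => map_add f _ _)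
      map_smul' := fun c Z => Prod.ext rfl (LinearMap.ext fun u => map_smul f _ _) }
  let χ : Y × (E →ₗ[K] K) →ₗ[K] K :=
    f ∘ₗ LinearMap.fst K _ _ - LinearMap.applyₗ (⟨e, heE⟩ : E) ∘ₗ LinearMap.snd K _ _
  have hχ : LinearMap.ker χ ≤ LinearMap.range Φ := by
    rintro ⟨w, q⟩ hwq
    have hwq' : f w = q ⟨e, heE⟩ := sub_eq_zero.1 (LinearMap.mem_ker.1 hwq)
    obtain ⟨q', hq'⟩ := q.exists_extend
    have hq'' : ∀ u : E, q' u = q u := fun u => LinearMap.congr_fun hq' u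
    -- The first term gives the column `w`; the second corrects the row and kills `e` by the
    -- compatibility `hwq'`.
    refine ⟨p.smulRight w + (q' - f w • p).smulRight v, Prod.ext ?_ (LinearMap.ext fun u => ?_)⟩
    · change p e • w + (q' e - f w * p e) • v = w
      rw [hp, one_smul, mul_one, hwq', hq'' ⟨e, heE⟩, sub_self, zero_smul, add_zero]
    · change f (p u • w + (q' u - f w * p u) • v) = q u
      rw [map_add, map_smul, map_smul, hv, hq'', smul_eq_mul, smul_eq_mul]
      ring
  have h1 := Submodule.finrank_mono hχ
  have h2 := χ.finrank_range_add_finrank_ker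
  have h3 : finrank K (LinearMap.range χ) ≤ 1 := by
    simpa using Submodule.finrank_le (LinearMap.range χ)
  rw [finrank_prod, Subspace.dual_finrank_eq] at h2
  have h4 := finrank_range_le_finrank_map_add Φ V
  have h5 : finrank K (V.map Φ) ≤ finrank K C := by
    let g : V.map Φ →ₗ[K] C := (LinearMap.fst K Y (E →ₗ[K] K)).restrict (by
      rintro _ ⟨Z, hZ, rfl⟩
      exact ⟨Z, hZ, rfl⟩)
    refine LinearMap.finrank_le_finrank_of_injective (f := g) ?_
    rw [injective_iff_map_eq_zero]
    rintro ⟨_, Z, hZ, rfl⟩ h0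
    have hZe : Z e = 0 := congrArg Subtype.val h0
    refine Subtype.ext (Prod.ext hZe (LinearMap.ext fun u => ?_))
    obtain ⟨X, hX, hXe⟩ := u.2
    exact hcon u ⟨X, hX, hXe⟩ Z hZ hZe
  omega

/-- Shift the linear solution by `x₀`, where `M e = N x₀`: the form `f ∘ Z` cannot vanish at both
`x₀` and `x₀ + x`. -/
lemma exists_row_apply_ne_zero_of_affine (h : IsCorankOne N e f) (hUY : finrank K U = finrank K Y)
    {V : Submodule K (U →ₗ[K] Y)} (hV : finrank K ((U →ₗ[K] Y) ⧸ V) + 2 ≤ finrank K U)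
    {M : U →ₗ[K] Y} (hM : f (M e) = 0) :
    ∃ x, (∃ X ∈ V, (M + X) e = N x) ∧ ∃ Z ∈ V, Z e = 0 ∧ f (Z x) ≠ 0 := by
  obtain ⟨x, ⟨X, hX, hXe⟩, Z, hZ, hZe, hZx⟩ := h.exists_row_apply_ne_zero hUY hV
  obtain ⟨x₀, hx₀⟩ := h.form_eq_zero_iff.1 hM
  by_cases h0 : f (Z x₀) = 0
  · refine ⟨x₀ + x, ⟨X, hX, ?_⟩, Z, hZ, hZe, ?_⟩
    · rw [LinearMap.add_apply, map_add, hx₀, hXe]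
    · rwa [map_add, map_add, h0, zero_add]
  · exact ⟨x₀, ⟨0, zero_mem _, by rw [add_zero, hx₀]⟩, Z, hZ, hZe, h0⟩

/-- If the block of `V` outside the first column and last row is full and `K` is finite,
choose the corner entry to be `1` and a block without eigenvalues. -/
lemma exists_injective_pencil_of_finite [Finite K] (h : IsCorankOne N e f)
    (hUY : finrank K U = finrank K Y) (hU : 3 ≤ finrank K U)
    {V : Submodule K (U →ₗ[K] Y)} (hVe : ∀ w, ∃ Z ∈ V, Z e = w)
    (hblock : ∀ Z : U →ₗ[K] Y, Z e = 0 → (∀ u, f (Z u) = 0) → Z ∈ V) (M : U →ₗ[K] Y) :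
    ∃ X ∈ V, ∀ t : K, Function.Injective (M + X + t • N) := by
  obtain ⟨v, hv⟩ := h.exists_form_eq_one hUY
  obtain ⟨X, hX, hXe⟩ := hVe (v - M e)
  let l : U →ₗ[K] K := f ∘ₗ (M + X)
  have hle : l e = 1 := by
    change f (M e + X e) = 1
    rw [hXe, add_sub_cancel, hv]
  have hrank := l.finrank_range_add_finrank_ker
  have hrange : finrank K (LinearMap.range l) ≤ 1 := by
    simpa using Submodule.finrank_le (LinearMap.range l)
  obtain ⟨R, hR⟩ := exists_endomorphism_forall_injective_add_smul (K := K) (W := LinearMap.ker l)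
    (by omega)
  let π : U →ₗ[K] LinearMap.ker l := (LinearMap.id - l.smulRight e).codRestrict _ fun u => by
    rw [LinearMap.mem_ker, LinearMap.sub_apply, map_sub, LinearMap.smulRight_apply, map_smul, hle,
      LinearMap.id_apply, smul_eq_mul, mul_one, sub_self]
  have hπ : ∀ u : LinearMap.ker l, π u = u := fun u => Subtype.ext (by
    change (u : U) - l u • e = u
    rw [LinearMap.mem_ker.1 u.2, zero_smul, sub_zero])
  have hπe : π e = 0 := Subtype.ext (by
    change e - l e • e = 0
    rw [hle, one_smul, sub_self])
  -- This `A` has the first column and last row of `M + X`. On the kernel of `l`, `A + tN` is `N ∘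
  -- (R + t)`, and `N` is injective there because `l e = 1`.
  let A : U →ₗ[K] Y := l.smulRight v + N ∘ₗ (LinearMap.ker l).subtype ∘ₗ R ∘ₗ π
  have hA : ∀ u, A u = l u • v + N (R (π u)) := fun u => rfl
  have hfA : ∀ u, f (A u) = l u := fun u => by
    rw [hA, map_add, map_smul, hv, h.form_apply, smul_eq_mul, mul_one, add_zero]
  have hmem : A - M ∈ V := by
    have : A - (M + X) ∈ V := hblock _ (by
      rw [LinearMap.sub_apply, hA, hle, hπe, LinearMap.add_apply, hXe]
      simp) (fun u => by
      rw [LinearMap.sub_apply, map_sub, hfA]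
      exact sub_self _)
    have h2 := add_mem this hX
    rwa [sub_add_eq_sub_sub, sub_add_cancel] at h2
  refine ⟨A - M, hmem, fun t => ?_⟩
  rw [add_sub_cancel, injective_iff_map_eq_zero]
  intro u hu
  rw [LinearMap.add_apply, LinearMap.smul_apply] at hu
  have hlu : l u = 0 := by
    have := congrArg f hu
    rwa [map_add, map_smul, h.form_apply, hfA, smul_zero, add_zero, map_zero] at this
  let w : LinearMap.ker l := ⟨u, hlu⟩
  have hw : N ((R w + t • w : LinearMap.ker l) : U) = 0 := by
    rw [hA, hlu, zero_smul, zero_add, show π u = w from hπ w] at hu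
    rw [← hu]
    simp [w]
  obtain ⟨c, hc⟩ := h.map_eq_zero_iff.1 hw
  have hc0 : c = 0 := by
    have := LinearMap.mem_ker.1 (R w + t • w).2
    rwa [← hc, map_smul, hle, smul_eq_mul, mul_one] at this
  have := hR t w (Subtype.ext (by rw [← hc, hc0, zero_smul]; rfl))
  exact congrArg Subtype.val this

end

end IsCorankOne

/-! ### The infinite field case, and the induction. -/

namespace IsCorankOne

universe u v
variable {K : Type u} [Field K]

/-- If the block of `V` outside the first column and last row is full and `K` is infinite,
there is a pencil with zero corner entry. -/
lemma exists_injective_pencil_of_infinite [Infinite K] {U Y : Type v} [AddCommGroup U] [Module K U]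
    [AddCommGroup Y] [Module K Y] [FiniteDimensional K U] [FiniteDimensional K Y]
    {N : U →ₗ[K] Y} {e : U} {f : Y →ₗ[K] K} (h : IsCorankOne N e f)
    (hYU : finrank K Y = finrank K U) (hU : 3 ≤ finrank K U)
    {V : Submodule K (U →ₗ[K] Y)} (hVe : ∀ w, ∃ Z ∈ V, Z e = w)
    (hblock : ∀ Z : U →ₗ[K] Y, Z e = 0 → (∀ u, f (Z u) = 0) → Z ∈ V)
    {Z : U →ₗ[K] Y} (hZ : Z ∈ V) (hZe : Z e = 0) {x : U} (hZx : f (Z x) ≠ 0) (M : U →ₗ[K] Y) :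
    ∃ X ∈ V, ∀ t : K, Function.Injective (M + X + t • N) := by
  by_contra hcon
  -- A nonzero row of this kind could be completed, and the full block puts the completion in the
  -- affine space.
  have hrow : ∀ x, N x ≠ 0 → ∀ X ∈ V, (M + X) e = N x → f ((M + X) x) = 0 →
      ∀ u, f ((M + X) u) = 0 := by
    intro x hx X hX hXe hXx
    by_contra! hne
    obtain ⟨u, hu⟩ := hne
    obtain ⟨A, hAe, hA, hinj⟩ := h.exists_injective_pencil_of_row_of_column (by omega) hYU hx
      (l := f ∘ₗ (M + X)) (fun h0 => hu (LinearMap.congr_fun h0 u))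
      (by rw [LinearMap.comp_apply, hXe, h.form_apply]) hXx
    have hmem : A - (M + X) ∈ V := hblock _
      (by rw [LinearMap.sub_apply, hAe, hXe, sub_self])
      (fun u => by rw [LinearMap.sub_apply, map_sub, hA, LinearMap.comp_apply, sub_self])
    refine hcon ⟨A - M, ?_, fun t => by rw [add_sub_cancel]; exact hinj t⟩
    have h2 := add_mem hmem hX
    rwa [sub_add_eq_sub_sub, sub_add_cancel] at h2
  let l : U →ₗ[K] K := f ∘ₗ Z
  have hle : l e = 0 := by rw [LinearMap.comp_apply, hZe, map_zero]
  have hsol : ∀ z, l z ≠ 0 → ∃ X ∈ V, (M + X) e = N z ∧ ∀ u, f ((M + X) u) = 0 := by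
    intro z hz
    obtain ⟨X, hX, hXe⟩ := hVe (N z - M e)
    obtain ⟨X', hX', hXe', hXz⟩ := exists_correct_row (M := M) hX hZ hZe hz
    rw [LinearMap.add_apply M X, hXe, add_sub_cancel] at hXe'
    exact ⟨X', hX', hXe', hrow z (h.apply_ne_zero hle hz) X' hX' hXe' hXz⟩
  -- Write `u = c x + (1 - c) z` with `l` nonzero at `x` and `z`, which needs `c ≠ 0, 1`. The
  -- solutions with columns `N x` and `N z` have zero row. Their affine combination plus `Z` has
  -- column `N u` and row `l ≠ 0` with `l u = 0`, against `hrow`.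
  obtain ⟨u, hlu, hu⟩ := exists_form_apply_eq_zero_of_one_lt e l (by omega)
  classical
  obtain ⟨c, hc⟩ := Infinite.exists_notMem_finset ({0, 1} : Finset K)
  rw [Finset.mem_insert, Finset.mem_singleton, not_or] at hc
  have hc1 : 1 - c ≠ 0 := sub_ne_zero.2 (Ne.symm hc.2)
  obtain ⟨X₁, hX₁, hXe₁, hXf₁⟩ := hsol x hZx
  obtain ⟨X₂, hX₂, hXe₂, hXf₂⟩ := hsol ((1 - c)⁻¹ • (u - c • x)) (by
    rw [map_smul, map_sub, map_smul, hlu, zero_sub, smul_eq_mul, smul_eq_mul]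
    exact mul_ne_zero (inv_ne_zero hc1) (neg_ne_zero.2 (mul_ne_zero hc.1 hZx)))
  have hsum : M + (c • X₁ + (1 - c) • X₂ + Z) = c • (M + X₁) + (1 - c) • (M + X₂) + Z := by
    module
  have hfx : ∀ w, f ((M + (c • X₁ + (1 - c) • X₂ + Z)) w) = l w := by
    intro w
    rw [hsum, LinearMap.add_apply, LinearMap.add_apply, LinearMap.smul_apply, LinearMap.smul_apply,
      map_add, map_add, map_smul, map_smul, hXf₁, hXf₂, smul_zero, smul_zero, zero_add, zero_add]
    rfl
  have hNu : N u ≠ 0 := fun h0 => hu (h.ker_eq ▸ h0)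
  have := hrow u hNu (c • X₁ + (1 - c) • X₂ + Z)
    (add_mem (add_mem (smul_mem _ _ hX₁) (smul_mem _ _ hX₂)) hZ) (by
      rw [hsum, LinearMap.add_apply, LinearMap.add_apply, LinearMap.smul_apply,
        LinearMap.smul_apply, hXe₁, hXe₂, hZe, ← map_smul, ← map_smul, smul_inv_smul₀ hc1,
        ← map_add, add_zero, add_sub_cancel]) (by rw [hfx, hlu]) x
  rw [hfx] at this
  exact hZx this

theorem exists_injective_pencil_of_codim_le (n : ℕ) : ∀ {U Y : Type v} [AddCommGroup U]
    [Module K U] [AddCommGroup Y] [Module K Y] [FiniteDimensional K U] [FiniteDimensional K Y]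
    {N : U →ₗ[K] Y} {e : U} {f : Y →ₗ[K] K} (_ : IsCorankOne N e f)
    (_ : finrank K U = n + 2) (_ : finrank K Y = n + 2) (V : Submodule K (U →ₗ[K] Y))
    (_ : finrank K ((U →ₗ[K] Y) ⧸ V) ≤ n) (M : U →ₗ[K] Y) (_ : f (M e) = 0),
    ∃ X ∈ V, ∀ t : K, Function.Injective (M + X + t • N) := by
  induction n with
  | zero =>
    intro U Y _ _ _ _ _ _ N e f h hU hY V hV M hM
    obtain ⟨x, -, Z, -, hZe, hZx⟩ :=
      h.exists_row_apply_ne_zero_of_affine (hU.trans hY.symm) (V := V) (by omega) hM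
    -- Here `V` is the whole space; `f ∘ₗ Z` only serves as a nonzero row vanishing at `e`.
    obtain ⟨A, -, hA⟩ := h.exists_injective_pencil 1 hU hY (f ∘ₗ Z)
      (fun h0 => hZx (LinearMap.congr_fun h0 x))
      (fun _ => by rw [LinearMap.comp_apply, hZe, map_zero])
    have hsub := finrank_zero_iff.1 (Nat.le_zero.1 hV)
    have htop : V = ⊤ := Submodule.Quotient.subsingleton_iff.1 hsub
    exact ⟨A - M, htop ▸ mem_top, fun t => by rw [add_sub_cancel]; exact hA t⟩
  | succ n ih =>
    intro U Y _ _ _ _ _ _ N e f h hU hY V hV M hM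
    by_contra hcon
    have hfull : ∀ x, N x ≠ 0 → ∀ X ∈ V, (M + X) e = N x → f ((M + X) x) = 0 →
        (∀ w, ∃ Z ∈ V, Z e = w) ∧ ∀ p : U →ₗ[K] K, p e = 0 → p.smulRight (N x) ∈ V := by
      intro x hx X hX hXe hXx
      by_contra hnot
      have hU' := finrank_quotient_span_singleton_add_one (K := K) h.ne_zero
      have hY' := finrank_quotient_span_singleton_add_one (K := K) hx
      have hV' := finrank_quotient_reducedSpace_lt h.ne_zero hnot
      let B : (U ⧸ span K {e}) →ₗ[K] (Y ⧸ span K {N x}) := mapQ _ _ (M + X) (by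
        rw [span_singleton_le_iff_mem, mem_comap, hXe]
        exact mem_span_singleton_self _)
      -- The strict drop `hV'` restores the codimension bound, and `hXx` is the hypothesis `f (M e)
      -- = 0` of the quotient problem, whose kernel vector is the class of `x`.
      obtain ⟨C, hC, hinj⟩ := ih (h.quotient hx) (by omega) (by omega) (reducedSpace V e (N x))
        (by omega) B hXx
      obtain ⟨Z, hZ, hZe, hCZ⟩ := exists_of_mem_reducedSpace hC
      refine hcon ⟨X + Z, add_mem hX hZ, fun t =>
        h.injective_of_quotient hx ?_ (B := B + C) (fun u => ?_) t (hinj t)⟩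
      · rw [← add_assoc, LinearMap.add_apply, hXe, hZe, add_zero]
      · rw [← add_assoc, LinearMap.add_apply, LinearMap.add_apply, map_add, ← hCZ]
        rfl
    obtain ⟨x₀, ⟨X₀, hX₀, hXe₀⟩, Z, hZ, hZe, hZx⟩ :=
      h.exists_row_apply_ne_zero_of_affine (hU.trans hY.symm) (V := V) (by omega) hM
    have hle : (f ∘ₗ Z) e = 0 := by rw [LinearMap.comp_apply, hZe, map_zero]
    have hVe : ∀ w, ∃ Z ∈ V, Z e = w := by
      obtain ⟨X, hX, hXe, hXx⟩ := exists_correct_row (M := M) hX₀ hZ hZe hZx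
      exact (hfull x₀ (h.apply_ne_zero hle hZx) X hX (hXe.trans hXe₀) hXx).1
    have hrank : ∀ x, f (Z x) ≠ 0 → ∀ p : U →ₗ[K] K, p e = 0 → p.smulRight (N x) ∈ V := by
      intro x hx
      obtain ⟨X, hX, hXe⟩ := hVe (N x - M e)
      obtain ⟨X', hX', hXe', hXx⟩ := exists_correct_row (M := M) hX hZ hZe hx
      rw [LinearMap.add_apply M X, hXe, add_sub_cancel] at hXe'
      exact (hfull x (h.apply_ne_zero hle hx) X' hX' hXe' hXx).2
    have hblock : ∀ Z : U →ₗ[K] Y, Z e = 0 → (∀ u, f (Z u) = 0) → Z ∈ V := by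
      refine fun _ => mem_of_smulRight_mem h.ne_zero fun p hp y hy => ?_
      obtain ⟨x, rfl⟩ := h.form_eq_zero_iff.1 hy
      -- The vectors where `f ∘ Z` is nonzero generate: otherwise write `x = (x + x₀) - x₀`.
      by_cases hx : f (Z x) = 0
      · have h1 := sub_mem (hrank (x + x₀) (by rwa [map_add, map_add, hx, zero_add]) p hp)
          (hrank x₀ hZx p hp)
        convert h1 using 1
        ext u
        rw [LinearMap.sub_apply, LinearMap.smulRight_apply, LinearMap.smulRight_apply,
          LinearMap.smulRight_apply, ← smul_sub, ← map_sub, add_sub_cancel_right]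
      · exact hrank x hx p hp
    rcases finite_or_infinite K with hK | hK
    · exact hcon (h.exists_injective_pencil_of_finite (hU.trans hY.symm) (by omega) hVe hblock M)
    · exact hcon (h.exists_injective_pencil_of_infinite (hY.trans hU.symm) (by omega) hVe hblock
        hZ hZe hZx M)

end IsCorankOne

/-! ### From matrices to corank one maps. -/

lemma LinearMap.exists_isCorankOne {K U Y : Type*} [Field K] [AddCommGroup U] [Module K U]
    [AddCommGroup Y] [Module K Y] [FiniteDimensional K U] [FiniteDimensional K Y]
    (N : U →ₗ[K] Y) (hU : finrank K (LinearMap.range N) + 1 = finrank K U)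
    (hY : finrank K (LinearMap.range N) + 1 = finrank K Y) :
    ∃ (e : U) (f : Y →ₗ[K] K), IsCorankOne N e f := by
  have h1 := N.finrank_range_add_finrank_ker
  obtain ⟨e, he, hspan⟩ := finrank_eq_one_iff'.1 (show finrank K (LinearMap.ker N) = 1 by omega)
  have hlt : LinearMap.range N < ⊤ := by
    refine lt_top_iff_ne_top.2 fun htop => ?_
    rw [htop, finrank_top] at hY
    omega
  obtain ⟨f, hf, hfN⟩ := exists_dual_map_eq_bot_of_lt_top hlt inferInstance
  have hle : LinearMap.range N ≤ LinearMap.ker f := fun y hy => by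
    rw [LinearMap.mem_ker, ← Submodule.mem_bot K, ← hfN]
    exact mem_map_of_mem hy
  have h2 := f.finrank_range_add_finrank_ker
  have h3 : finrank K (LinearMap.range f) = 1 := by
    rw [LinearMap.range_eq_top.2 (LinearMap.surjective hf), finrank_top, finrank_self]
  refine ⟨e, f, fun h0 => he (Subtype.ext h0), le_antisymm (fun u hu => ?_) ?_,
    eq_of_le_of_finrank_eq hle (by omega)⟩
  · obtain ⟨c, hc⟩ := hspan ⟨u, hu⟩
    exact mem_span_singleton.2 ⟨c, congrArg Subtype.val hc⟩
  · rw [span_singleton_le_iff_mem]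
    exact e.2

theorem mainTheorem2 {K : Type*} [Field K] (n : ℕ)
    (N : Matrix (Fin n) (Fin n) K) (hN : N.rank + 1 = n)
    (S : AffineSubspace K (Matrix (Fin n) (Fin n) K))
    (hS : Module.finrank K (Matrix (Fin n) (Fin n) K ⧸ S.direction) + 2 ≤ n)
    (hM : ∃ M ∈ S, ∀ x : Fin n → K, N.mulVec x = 0 → ∃ y : Fin n → K, N.mulVec y = M.mulVec x) :
    ∃ A ∈ S, ∀ t : K, IsUnit (A + t • N) := by
  obtain ⟨M, hMS, hM⟩ := hM
  have hdim : finrank K (Fin n → K) = n := finrank_fin_fun K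
  have hrank : finrank K (LinearMap.range (Matrix.toLin' N)) + 1 = n := hN
  obtain ⟨e, f, h⟩ := (Matrix.toLin' N).exists_isCorankOne (hrank.trans hdim.symm)
    (hrank.trans hdim.symm)
  let φ : Matrix (Fin n) (Fin n) K ≃ₗ[K] ((Fin n → K) →ₗ[K] (Fin n → K)) := Matrix.toLin'
  have hcodim := (Submodule.Quotient.equiv S.direction (S.direction.map φ.toLinearMap) φ rfl).finrank_eq
  obtain ⟨m, rfl⟩ := Nat.exists_eq_add_of_le' (show 2 ≤ n by omega)
  obtain ⟨X, hX, hinj⟩ := h.exists_injective_pencil_of_codim_le m hdim hdim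
    (S.direction.map φ.toLinearMap) (by omega) (Matrix.toLin' M)
    (h.form_eq_zero_iff.2 (hM e h.apply_self))
  obtain ⟨X, hX, rfl⟩ := hX
  refine ⟨X + M, AffineSubspace.vadd_mem_of_mem_direction hX hMS, fun t => ?_⟩
  rw [← Matrix.mulVec_injective_iff_isUnit]
  convert hinj t using 1
  rw [add_comm X M]
  change _ = ⇑(Matrix.toLin' M + Matrix.toLin' X + t • Matrix.toLin' N)
  rw [← map_smul, ← map_add, ← map_add]
  rfl
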